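/- Let $\mathbb{K}$ be an algebraically closed field, let $n\ge 0$, and let $q_{ij}\in\mathbb{K}^\times$ ($1\le i,j\le n$) satisfy $q_{ii}=1$ and $q_{ji}=q_{ij}^{-1}$ for all $i,j$. Let $A=\mathcal{O}_{\mathbf q}(\mathbb{K}^n)$ be the corresponding quantum affine space, i.e. the associative unital $\mathbb{K}$-algebra generated by $x_1,\dots,x_n$ subject to the relations $x_ix_j=q_{ij}x_jx_i$ for all $i,j$. Call a left $A$-module $M$ locally finite if $\dim_{\mathbb{K}}(Am)<\infty$ for every $m\in M$. Then locally finite $A$-modules are closed under essential extensions: if $E$ is a left $A$-module and $V\subseteq E$ is an essential submodule (that is, $V\cap W\neq 0$ for every nonzero submodule $W\subseteq E$) which is locally finite, then $E$ is locally finite. -/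

import Mathlib

/-- The defining relations `x_i x_j = q_{ij} x_j x_i` of quantum affine `n`-space, inside the
free algebra on the generators `x_i`. -/
inductive QuantumAffineRel {K : Type*} [Field K] {n : ℕ} (q : Fin n → Fin n → Kˣ) :
    FreeAlgebra K (Fin n) → FreeAlgebra K (Fin n) → Prop
  | rel (i j : Fin n) : QuantumAffineRel q
      (FreeAlgebra.ι K i * FreeAlgebra.ι K j)
      ((q i j : K) • (FreeAlgebra.ι K j * FreeAlgebra.ι K i))

/-- The quantum affine space `O_q(K^n)`: the associative unital `K`-algebra generated by
`x_1, …, x_n` subject to the relations `x_i x_j = q_{ij} x_j x_i`. -/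
abbrev QuantumAffineSpace {K : Type*} [Field K] {n : ℕ} (q : Fin n → Fin n → Kˣ) : Type _ :=
  RingQuot (QuantumAffineRel q)

/-- A left `A`-module `M` over a `K`-algebra `A` is locally finite if every cyclic submodule `A m`
is finite dimensional over `K`. -/
def IsLocallyFiniteRep (K A M : Type*) [Field K] [Ring A] [Algebra K A] [AddCommGroup M]
    [Module K M] [Module A M] [IsScalarTower K A M] : Prop :=
  ∀ m : M, FiniteDimensional K (Submodule.span A {m})

/-- A submodule is essential if it meets every nonzero submodule nontrivially. -/
def IsEssentialSubmodule {A M : Type*} [Ring A] [AddCommGroup M] [Module A M]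
    (V : Submodule A M) : Prop :=
  ∀ W : Submodule A M, W ≠ ⊥ → V ⊓ W ≠ ⊥

/-! Local finiteness is tested on cyclic submodules. `A` is left Noetherian (Gröbner-style leading
exponents and Dickson's lemma), so it suffices that a Noetherian module with a finite dimensional
essential submodule `V` is finite dimensional (`finiteDimensional_of_essential`). For a submodule
`W`, the kernels of the powers of `x i` stabilize, so a Fitting-type argument reduces `W` to the
kernel of `x i` and the image of `x i ^ N`, where `x i` is zero or injective. Once this holds for
every `i`, let `d = dim (V ⊓ W)`. Determinants on `V ⊓ W` show that the scalars between injective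
generators are `d`-th roots of unity, so `x i ^ d` commutes with all generators on `W`. If `p` is
its minimal polynomial on `V ⊓ W`, then `p (x i ^ d)` kills an essential part of `W`, hence is
nilpotent. All generators are thus algebraic on the finitely generated `W`, which is therefore
finite dimensional. -/

/-! ### Noetherianity via leading exponents. -/

section Noetherian

variable {K A ι : Type*} [Field K] [Ring A] [Algebra K A]

/-- The elements `x i` commute pairwise up to nonzero scalars. -/
def PairwiseQCommute (K : Type*) {A ι : Type*} [Field K] [Ring A] [Algebra K A]
    (x : ι → A) : Prop :=
  ∀ i j, ∃ c : K, c ≠ 0 ∧ x i * x j = c • (x j * x i)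

theorem PairwiseQCommute.prod_perm {x : ι → A} (hx : PairwiseQCommute K x) {l l' : List ι}
    (h : l.Perm l') : ∃ c : K, c ≠ 0 ∧ (l.map x).prod = c • (l'.map x).prod := by
  induction h with
  | nil => exact ⟨1, one_ne_zero, by simp⟩
  | cons i _ ih =>
    obtain ⟨c, hc, h⟩ := ih
    exact ⟨c, hc, by simp [h]⟩
  | swap i j l =>
    obtain ⟨c, hc, h⟩ := hx j i
    exact ⟨c, hc, by simp [← mul_assoc, h]⟩
  | trans _ _ ih₁ ih₂ =>
    obtain ⟨c, hc, h⟩ := ih₁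
    obtain ⟨d, hd, h'⟩ := ih₂
    exact ⟨c * d, mul_ne_zero hc hd, by rw [h, h', mul_smul]⟩

/-- The monomial with exponent `α` in the family `x`, the factors being taken in some order. -/
noncomputable def orderedMonomial (x : ι → A) (α : ι →₀ ℕ) : A :=
  ((Finsupp.toMultiset α).toList.map x).prod

theorem PairwiseQCommute.mul_orderedMonomial {x : ι → A} (hx : PairwiseQCommute K x) (i : ι)
    (α : ι →₀ ℕ) : ∃ c : K, c ≠ 0 ∧
      x i * orderedMonomial x α = c • orderedMonomial x (Finsupp.single i 1 + α) := by
  have h : (i :: (Finsupp.toMultiset α).toList).Perm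
      (Finsupp.toMultiset (Finsupp.single i 1 + α)).toList := by
    rw [← Multiset.coe_eq_coe, ← Multiset.cons_coe]
    simp [Finsupp.toMultiset_add, Finsupp.toMultiset_single]
  obtain ⟨c, hc, e⟩ := hx.prod_perm h
  exact ⟨c, hc, by simpa [orderedMonomial] using e⟩

theorem span_orderedMonomial_eq_top {x : ι → A} (hx : PairwiseQCommute K x)
    (htop : Algebra.adjoin K (Set.range x) = ⊤) :
    Submodule.span K (Set.range (orderedMonomial x)) = ⊤ := by
  rw [← top_le_iff, ← Algebra.top_toSubmodule, ← htop, Algebra.adjoin_eq_span,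
    Submodule.span_le]
  intro a ha
  induction ha using Submonoid.closure_induction_left with
  | one => exact Submodule.subset_span ⟨0, by simp [orderedMonomial]⟩
  | mul_left y hy z _ ih =>
    obtain ⟨i, rfl⟩ := hy
    have : Submodule.span K (Set.range (orderedMonomial x)) ≤
        (Submodule.span K (Set.range (orderedMonomial x))).comap (LinearMap.mulLeft K (x i)) := by
      rw [Submodule.span_le]
      rintro _ ⟨α, rfl⟩
      obtain ⟨c, -, h⟩ := hx.mul_orderedMonomial i α
      rw [SetLike.mem_coe, Submodule.mem_comap, LinearMap.mulLeft_apply, h]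
      exact Submodule.smul_mem _ _ (Submodule.subset_span ⟨_, rfl⟩)
    exact this ih

variable (K) in
/-- The span of the monomials smaller than `α`. -/
def lowerSpan (m : MonomialOrder ι) (x : ι → A) (α : ι →₀ ℕ) : Submodule K A :=
  Submodule.span K (orderedMonomial x '' {β | m.toSyn β < m.toSyn α})

variable (K) in
/-- The exponents of the leading monomials of the elements of a left ideal. -/
def leadingExponents (m : MonomialOrder ι) (x : ι → A) (I : Submodule A A) : Set (ι →₀ ℕ) :=
  {α | orderedMonomial x α ∈ I.restrictScalars K ⊔ lowerSpan K m x α}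

variable {m : MonomialOrder ι} {x : ι → A}

theorem leadingExponents_mono {I J : Submodule A A} (h : I ≤ J) :
    leadingExponents K m x I ⊆ leadingExponents K m x J :=
  fun _ hα ↦ sup_le_sup_right (show I.restrictScalars K ≤ J.restrictScalars K from h) _ hα

theorem lowerSpan_mono {α β : ι →₀ ℕ} (h : m.toSyn α ≤ m.toSyn β) :
    lowerSpan K m x α ≤ lowerSpan K m x β :=
  Submodule.span_mono (Set.image_mono fun _ hγ ↦ lt_of_lt_of_le hγ h)

theorem orderedMonomial_mem_lowerSpan {α β : ι →₀ ℕ} (h : m.toSyn α < m.toSyn β) :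
    orderedMonomial x α ∈ lowerSpan K m x β :=
  Submodule.subset_span ⟨α, h, rfl⟩

theorem PairwiseQCommute.mul_mem_lowerSpan (hx : PairwiseQCommute K x) (i : ι) {α : ι →₀ ℕ}
    {a : A} (ha : a ∈ lowerSpan K m x α) :
    x i * a ∈ lowerSpan K m x (Finsupp.single i 1 + α) := by
  have : lowerSpan K m x α ≤
      (lowerSpan K m x (Finsupp.single i 1 + α)).comap (LinearMap.mulLeft K (x i)) := by
    rw [lowerSpan, Submodule.span_le]
    rintro _ ⟨β, hβ, rfl⟩
    obtain ⟨c, -, h⟩ := hx.mul_orderedMonomial i β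
    rw [SetLike.mem_coe, Submodule.mem_comap, LinearMap.mulLeft_apply, h]
    refine Submodule.smul_mem _ _ (orderedMonomial_mem_lowerSpan ?_)
    rw [map_add, map_add]
    exact add_lt_add_right hβ _
  exact this ha

theorem PairwiseQCommute.single_add_mem_leadingExponents (hx : PairwiseQCommute K x) (i : ι)
    {I : Submodule A A} {α : ι →₀ ℕ} (hα : α ∈ leadingExponents K m x I) :
    Finsupp.single i 1 + α ∈ leadingExponents K m x I := by
  obtain ⟨a, ha, b, hb, hab⟩ := Submodule.mem_sup.1 hα
  obtain ⟨c, hc, h⟩ := hx.mul_orderedMonomial i α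
  rw [leadingExponents, Set.mem_ofPred_eq, ← Submodule.smul_mem_iff _ hc, ← h, ← hab, mul_add]
  exact add_mem (Submodule.mem_sup_left (I.smul_mem (x i) ha))
    (Submodule.mem_sup_right (hx.mul_mem_lowerSpan i hb))

theorem PairwiseQCommute.isUpperSet_leadingExponents (hx : PairwiseQCommute K x)
    (I : Submodule A A) : IsUpperSet (leadingExponents K m x I) := by
  intro α β hαβ hα
  obtain ⟨γ, rfl⟩ := exists_add_of_le hαβ
  clear hαβ
  induction γ using Finsupp.induction_linear generalizing α with
  | zero => simpa using hα
  | add γ δ hγ hδ => simpa [add_assoc] using hδ (hγ hα)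
  | single i k =>
    induction k with
    | zero => simpa using hα
    | succ k ih =>
      have := hx.single_add_mem_leadingExponents i ih
      rwa [add_left_comm, ← Finsupp.single_add, add_comm 1 k] at this

/-- Monomials are not assumed independent: `β` need not be unique and `c` may be zero. Only `β ∈ S`
and the smaller remainder matter. -/
theorem eq_zero_or_exists_leading_term (m : MonomialOrder ι) {S : Set (ι →₀ ℕ)} {a : A}
    (ha : a ∈ Submodule.span K (orderedMonomial x '' S)) :
    a = 0 ∨ ∃ β ∈ S, ∃ c : K, ∃ b ∈ lowerSpan K m x β,
      a = c • orderedMonomial x β + b := by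
  induction ha using Submodule.span_induction with
  | zero => exact .inl rfl
  | mem a h =>
    obtain ⟨β, hβ, rfl⟩ := h
    exact .inr ⟨β, hβ, 1, 0, zero_mem _, by simp⟩
  | smul k a _ h =>
    obtain rfl | ⟨β, hβ, c, b, hb, rfl⟩ := h
    · exact .inl (smul_zero _)
    · exact .inr ⟨β, hβ, k * c, k • b, Submodule.smul_mem _ _ hb, by rw [smul_add, mul_smul]⟩
  | add a a' _ _ h h' =>
    obtain rfl | ⟨β, hβ, c, b, hb, rfl⟩ := h
    · simpa using h'
    obtain rfl | ⟨β', hβ', c', b', hb', rfl⟩ := h'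
    · exact .inr ⟨β, hβ, c, b, hb, by simp⟩
    right
    have key : ∀ {γ γ' : ι →₀ ℕ} {d d' : K} {e e' : A}, m.toSyn γ' < m.toSyn γ →
        e ∈ lowerSpan K m x γ → e' ∈ lowerSpan K m x γ' → ∃ f ∈ lowerSpan K m x γ,
        (d • orderedMonomial x γ + e) + (d' • orderedMonomial x γ' + e') =
          d • orderedMonomial x γ + f := by
      intro γ γ' d d' e e' h he he'
      exact ⟨e + (d' • orderedMonomial x γ' + e'), add_mem he
        (add_mem (Submodule.smul_mem _ _ (orderedMonomial_mem_lowerSpan h))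
          (lowerSpan_mono h.le he')), by abel⟩
    rcases lt_trichotomy (m.toSyn β) (m.toSyn β') with h | h | h
    · obtain ⟨f, hf, e⟩ := key (d := c') (d' := c) h hb' hb
      exact ⟨β', hβ', c', f, hf, by rw [add_comm, e]⟩
    · obtain rfl := m.toSyn.injective h
      exact ⟨β, hβ, c + c', b + b', add_mem hb hb', by rw [add_smul]; abel⟩
    · obtain ⟨f, hf, e⟩ := key (d := c) (d' := c') h hb hb'
      exact ⟨β, hβ, c, f, hf, e⟩

/-- Division by well-founded induction: subtracting from `a ∈ J` an element of `I` with the same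
leading term leaves an element of `J` of smaller exponent. -/
theorem le_of_leadingExponents_subset (hx : PairwiseQCommute K x)
    (htop : Algebra.adjoin K (Set.range x) = ⊤) {I J : Submodule A A} (hIJ : I ≤ J)
    (h : leadingExponents K m x J ⊆ leadingExponents K m x I) : J ≤ I := by
  have main : ∀ s : m.syn, ∀ a ∈ J, ∀ α : ι →₀ ℕ, m.toSyn α = s → ∀ c : K,
      ∀ b ∈ lowerSpan K m x α, a = c • orderedMonomial x α + b → a ∈ I := by
    intro s
    induction s using WellFoundedLT.induction with
    | ind s ih =>
    have low : ∀ a ∈ J, ∀ α : ι →₀ ℕ, m.toSyn α = s → a ∈ lowerSpan K m x α → a ∈ I := by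
      rintro a ha α rfl haα
      obtain rfl | ⟨β, hβ, c, b, hb, e⟩ := eq_zero_or_exists_leading_term m haα
      · exact zero_mem _
      · exact ih _ hβ a ha β rfl c b hb e
    intro a ha α hα c b hb e
    by_cases hc : c = 0
    · exact low a ha α hα (by simpa [e, hc] using hb)
    have hmem : α ∈ leadingExponents K m x J := by
      rw [leadingExponents, Set.mem_ofPred_eq, ← Submodule.smul_mem_iff _ hc,
        eq_sub_of_add_eq e.symm]
      exact sub_mem (Submodule.mem_sup_left ha) (Submodule.mem_sup_right hb)
    obtain ⟨u, hu, v, hv, huv⟩ := Submodule.mem_sup.1 (h hmem)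
    have hcu : c • u ∈ I := (I.restrictScalars K).smul_mem c hu
    rw [← sub_add_cancel a (c • u)]
    refine add_mem (low _ (sub_mem ha (hIJ hcu)) α hα ?_) hcu
    have : a - c • u = c • v + b := by rw [e, ← huv, smul_add]; abel
    rw [this]
    exact add_mem (Submodule.smul_mem _ _ hv) hb
  intro a ha
  have hspan : a ∈ Submodule.span K (Set.range (orderedMonomial x)) := by
    rw [span_orderedMonomial_eq_top hx htop]; trivial
  rw [← Set.image_univ] at hspan
  obtain rfl | ⟨α, -, c, b, hb, e⟩ := eq_zero_or_exists_leading_term m hspan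
  · exact zero_mem _
  · exact main _ a ha α rfl c b hb e

theorem PairwiseQCommute.isNoetherianRing [Finite ι] (m : MonomialOrder ι)
    (hx : PairwiseQCommute K x) (htop : Algebra.adjoin K (Set.range x) = ⊤) :
    IsNoetherianRing A := by
  rw [isNoetherianRing_iff, isNoetherian_iff, RelEmbedding.wellFounded_iff_isEmpty]
  refine ⟨fun I ↦ ?_⟩
  have hI : ∀ k, I k < I (k + 1) := fun k ↦ I.map_rel_iff.2 k.lt_succ_self
  have hmono : StrictMono I := strictMono_nat_of_lt_succ hI
  have hex : ∀ k, ∃ α, α ∈ leadingExponents K m x (I (k + 1)) ∧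
      α ∉ leadingExponents K m x (I k) := fun k ↦ by
    by_contra! h
    exact (hI k).not_ge (le_of_leadingExponents_subset hx htop (hI k).le h)
  choose α hα hα' using hex
  -- Dickson's lemma: the exponent new at stage `l` lies above one already present at stage `k + 1 ≤
  -- l`.
  obtain ⟨k, l, hkl, hle⟩ := wellQuasiOrdered_le α
  exact hα' l (hx.isUpperSet_leadingExponents _ hle
    (leadingExponents_mono (hmono.monotone (Nat.succ_le_of_lt hkl)) (hα k)))

end Noetherian

/-! ### Operators commuting with the generators up to scalars. -/

section LocallyFinite

variable {K A ι M : Type*} [Field K] [Ring A] [Algebra K A] [AddCommGroup M] [Module K M]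
  [Module A M] [IsScalarTower K A M] {x : ι → A}

/-- A subspace stable under a family generating the algebra is a submodule. -/
def Submodule.ofStable (htop : Algebra.adjoin K (Set.range x) = ⊤) (P : Submodule K M)
    (hP : ∀ i, ∀ w ∈ P, x i • w ∈ P) : Submodule A M where
  __ := P.toAddSubmonoid
  smul_mem' a w hw := by
    have ha : a ∈ Algebra.adjoin K (Set.range x) := by rw [htop]; trivial
    change a • w ∈ P
    replace hw : w ∈ P := hw
    induction ha using Algebra.adjoin_induction generalizing w with
    | mem a h => obtain ⟨i, rfl⟩ := h; exact hP i w hw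
    | algebraMap r => rw [algebraMap_smul]; exact P.smul_mem r hw
    | add a b _ _ ha hb => rw [add_smul]; exact P.add_mem (ha w hw) (hb w hw)
    | mul a b _ _ ha hb => rw [mul_smul]; exact ha _ (hb w hw)

/-- The operator `f` preserves `W` and commutes there with each `x i` up to a nonzero scalar. -/
def QCommutesOn (x : ι → A) (W : Submodule A M) (f : Module.End K M) : Prop :=
  (∀ w ∈ W, f w ∈ W) ∧ ∀ i, ∃ c : K, c ≠ 0 ∧ ∀ w ∈ W, f (x i • w) = c • x i • f w

theorem smul_mem_of_smul {W : Submodule A M} (c : K) {w : M} (hw : w ∈ W) : c • w ∈ W :=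
  (W.restrictScalars K).smul_mem c hw

omit [Algebra K A] [IsScalarTower K A M] in
theorem QCommutesOn.pow {W : Submodule A M} {f : Module.End K M} (hf : QCommutesOn x W f)
    (k : ℕ) : QCommutesOn x W (f ^ k) := by
  induction k with
  | zero => exact ⟨fun w hw ↦ hw, fun i ↦ ⟨1, one_ne_zero, fun w _ ↦ by simp⟩⟩
  | succ k ih =>
    refine ⟨fun w hw ↦ ?_, fun i ↦ ?_⟩
    · rw [pow_succ', Module.End.mul_apply]
      exact hf.1 _ (ih.1 w hw)
    · obtain ⟨c, hc, h⟩ := ih.2 i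
      obtain ⟨d, hd, h'⟩ := hf.2 i
      refine ⟨c * d, mul_ne_zero hc hd, fun w hw ↦ ?_⟩
      rw [pow_succ', Module.End.mul_apply, h w hw, map_smul, h' _ (ih.1 w hw), mul_smul,
        Module.End.mul_apply]

theorem qCommutesOn_smul (hx : PairwiseQCommute K x) (i : ι) (W : Submodule A M) :
    QCommutesOn x W (Algebra.lsmul K K M (x i)) := by
  refine ⟨fun w hw ↦ W.smul_mem _ hw, fun j ↦ ?_⟩
  obtain ⟨c, hc, h⟩ := hx i j
  refine ⟨c, hc, fun w _ ↦ ?_⟩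
  change x i • x j • w = c • x j • x i • w
  rw [← mul_smul, h, smul_assoc, mul_smul]

/-- The kernel of `f` on `W`, as a submodule. -/
def QCommutesOn.ker (htop : Algebra.adjoin K (Set.range x) = ⊤) {W : Submodule A M}
    {f : Module.End K M} (hf : QCommutesOn x W f) : Submodule A M :=
  Submodule.ofStable htop (W.restrictScalars K ⊓ LinearMap.ker f) fun i w hw ↦ by
    obtain ⟨c, -, h⟩ := hf.2 i
    refine ⟨W.smul_mem _ hw.1, ?_⟩
    rw [SetLike.mem_coe, LinearMap.mem_ker, h w hw.1, LinearMap.mem_ker.1 hw.2, smul_zero,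
      smul_zero]

/-- The image of `W` under `f`, as a submodule. -/
def QCommutesOn.map (htop : Algebra.adjoin K (Set.range x) = ⊤) {W : Submodule A M}
    {f : Module.End K M} (hf : QCommutesOn x W f) : Submodule A M :=
  Submodule.ofStable htop ((W.restrictScalars K).map f) fun i w hw ↦ by
    obtain ⟨w, hw, rfl⟩ := hw
    obtain ⟨c, hc, h⟩ := hf.2 i
    refine ⟨c⁻¹ • x i • w, smul_mem_of_smul _ (W.smul_mem _ hw), ?_⟩
    rw [map_smul, h w hw, inv_smul_smul₀ hc]

theorem QCommutesOn.exists_pow_ker_stable [IsNoetherian A M]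
    (htop : Algebra.adjoin K (Set.range x) = ⊤) {W : Submodule A M} {f : Module.End K M}
    (hf : QCommutesOn x W f) : ∃ N, ∀ w ∈ W, (f ^ (N + 1)) w = 0 → (f ^ N) w = 0 := by
  have hmono : Monotone fun k ↦ (hf.pow k).ker htop := by
    refine monotone_nat_of_le_succ fun k w hw ↦ ⟨hw.1, ?_⟩
    rw [SetLike.mem_coe, LinearMap.mem_ker, pow_succ', Module.End.mul_apply,
      LinearMap.mem_ker.1 hw.2, map_zero]
  obtain ⟨N, hN⟩ := monotone_stabilizes_iff_noetherian.2 ‹IsNoetherian A M› ⟨_, hmono⟩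
  refine ⟨N, fun w hw h ↦ ?_⟩
  have h' : w ∈ (hf.pow (N + 1)).ker htop := ⟨hw, h⟩
  have e : (hf.pow N).ker htop = (hf.pow (N + 1)).ker htop := hN (N + 1) N.le_succ
  rw [← e] at h'
  exact h'.2

/-- An operator that vanishes on an essential submodule is nilpotent. -/
theorem QCommutesOn.exists_pow_eq_zero [IsNoetherian A M]
    (htop : Algebra.adjoin K (Set.range x) = ⊤) {V W : Submodule A M}
    (hV : IsEssentialSubmodule V) {f : Module.End K M}
    (hf : QCommutesOn x W f) (h : ∀ w ∈ V ⊓ W, f w = 0) : ∃ N, ∀ w ∈ W, (f ^ N) w = 0 := by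
  obtain ⟨N, hN⟩ := hf.exists_pow_ker_stable htop
  refine ⟨N, fun w hw ↦ ?_⟩
  have hbot : (hf.pow N).map htop = ⊥ := by
    by_contra hne
    -- An element `(f ^ N) w` of `V` is killed by `f`, so it vanishes by stability of the kernels.
    refine hV _ hne ((Submodule.eq_bot_iff _).2 ?_)
    rintro _ ⟨hv, w, hw, rfl⟩
    refine hN w hw ?_
    rw [pow_succ', Module.End.mul_apply]
    exact h _ ⟨hv, (hf.pow N).1 w hw⟩
  have : (f ^ N) w ∈ (hf.pow N).map htop := ⟨w, hw, rfl⟩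
  rwa [hbot] at this

/-! ### Finite dimensionality from algebraic generators. -/

theorem Submodule.map_pow_le {P : Submodule K M} {f : Module.End K M}
    (hP : ∀ w ∈ P, f w ∈ P) (N : ℕ) : P.map (f ^ N) ≤ P := by
  induction N with
  | zero => simp [Module.End.one_eq_id]
  | succ N ih =>
    rintro _ ⟨w, hw, rfl⟩
    rw [pow_succ', Module.End.mul_apply]
    exact hP _ (ih ⟨w, hw, rfl⟩)

/-- Peel off one power at a time: `f` maps `f ^ N P` onto `f ^ (N + 1) P` with kernel inside `P ⊓
ker f`. -/
theorem Submodule.fg_of_fg_map_pow {P : Submodule K M} {f : Module.End K M}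
    (hP : ∀ w ∈ P, f w ∈ P) (hker : (P ⊓ LinearMap.ker f).FG) (N : ℕ)
    (h : (P.map (f ^ N)).FG) : P.FG := by
  induction N with
  | zero => simpa [Module.End.one_eq_id] using h
  | succ N ih =>
    refine ih (Submodule.fg_of_fg_map_of_fg_inf_ker f ?_ ?_)
    · rwa [← Submodule.map_comp, ← Module.End.mul_eq_comp, ← pow_succ']
    · have := Module.Finite.iff_fg.2 hker
      exact Module.Finite.iff_fg.1
        (Submodule.finiteDimensional_of_le (inf_le_inf_right _ (Submodule.map_pow_le hP N)))

theorem Polynomial.Monic.pow_apply_mem {p : Polynomial K} (hp : p.Monic) {f : Module.End K M}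
    {w : M} (hw : Polynomial.aeval f p w = 0) {G : Submodule K M}
    (hG : ∀ k < p.natDegree, (f ^ k) w ∈ G) (k : ℕ) : (f ^ k) w ∈ G := by
  induction k using Nat.strong_induction_on with
  | _ k ih =>
    obtain h | h := lt_or_ge k p.natDegree
    · exact hG k h
    obtain ⟨r, rfl⟩ := Nat.exists_eq_add_of_le' h
    have e : (f ^ p.natDegree) w =
        -∑ b ∈ Finset.range p.natDegree, p.coeff b • (f ^ b) w := by
      rw [hp.as_sum] at hw
      simpa [← Algebra.smul_def, LinearMap.sum_apply, ← eq_neg_iff_add_eq_zero] using hw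
    rw [pow_add, Module.End.mul_apply, e, map_neg, map_sum]
    refine G.neg_mem (G.sum_mem fun b hb ↦ ?_)
    rw [map_smul, ← Module.End.mul_apply, ← pow_add]
    exact G.smul_mem _ (ih _ (Nat.add_lt_add_left (Finset.mem_range.1 hb) r))

/-- Treat generators one by one, replacing `F` by the sum of all `x i ^ a F`. Algebraicity makes the
sum finite, and commutation up to scalars keeps it stable under the earlier generators. -/
theorem exists_fg_stable (W : Submodule A M)
    (halg : ∀ i, ∃ p : Polynomial K, p.Monic ∧
      ∀ w ∈ W, Polynomial.aeval (Algebra.lsmul K K M (x i)) p w = 0)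
    (hx : PairwiseQCommute K x) (s : Finset M) (hs : (s : Set M) ⊆ W) (T : Finset ι) :
    ∃ F : Submodule K M, F.FG ∧ F ≤ W.restrictScalars K ∧ (s : Set M) ⊆ F ∧
      ∀ i ∈ T, ∀ w ∈ F, x i • w ∈ F := by
  classical
  induction T using Finset.induction_on with
  | empty =>
    exact ⟨Submodule.span K s, ⟨s, rfl⟩, Submodule.span_le.2 hs, Submodule.subset_span, by simp⟩
  | insert i T _ ih =>
    obtain ⟨F, hF, hFW, hsF, hst⟩ := ih
    obtain ⟨p, hp, hpW⟩ := halg i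
    set f := Algebra.lsmul K K M (x i) with hf
    have hmem : ∀ k, ∀ w ∈ F, (f ^ k) w ∈ ⨆ a, F.map (f ^ a) := fun k w hw ↦
      Submodule.mem_iSup_of_mem k ⟨w, hw, rfl⟩
    have hstab : ∀ j, (∀ a, ∀ w ∈ F, x j • (f ^ a) w ∈ ⨆ a, F.map (f ^ a)) →
        ∀ w ∈ ⨆ a, F.map (f ^ a), x j • w ∈ ⨆ a, F.map (f ^ a) := by
      intro j h w hw
      have hle : (⨆ a, F.map (f ^ a)) ≤
          (⨆ a, F.map (f ^ a)).comap (Algebra.lsmul K K M (x j)) := by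
        refine iSup_le fun a ↦ ?_
        rintro _ ⟨w, hw, rfl⟩
        exact h a w hw
      exact hle hw
    have hfin : (⨆ a, F.map (f ^ a)) = ⨆ a ∈ Finset.range p.natDegree, F.map (f ^ a) := by
      refine le_antisymm (iSup_le fun a ↦ ?_) (iSup₂_le fun a _ ↦ le_iSup (fun a ↦ F.map (f ^ a)) a)
      rintro _ ⟨w, hw, rfl⟩
      refine hp.pow_apply_mem (hpW w (hFW hw)) (fun k hk ↦ ?_) a
      exact Submodule.mem_iSup_of_mem k (Submodule.mem_iSup_of_mem (Finset.mem_range.2 hk)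
        ⟨w, hw, rfl⟩)
    refine ⟨⨆ a, F.map (f ^ a), ?_, ?_, ?_, ?_⟩
    · rw [hfin]
      exact Submodule.fg_biSup _ _ fun a _ ↦ hF.map _
    · exact iSup_le fun a ↦ (Submodule.map_mono hFW).trans
        (Submodule.map_pow_le (fun w hw ↦ W.smul_mem _ hw) a)
    · intro w hw
      simpa using hmem 0 w (hsF hw)
    · intro j hj
      refine hstab j fun a w hw ↦ ?_
      obtain rfl | hj := Finset.mem_insert.1 hj
      · have := hmem (a + 1) w hw
        rwa [pow_succ', Module.End.mul_apply] at this
      · obtain ⟨c, hc, h⟩ := (qCommutesOn_smul hx i W).pow a |>.2 j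
        have := Submodule.smul_mem _ c⁻¹ (hmem a _ (hst j hj w hw))
        rwa [h w (hFW hw), inv_smul_smul₀ hc] at this

/-- If a finitely generated module has all `x i` acting algebraically, it is finite
dimensional. -/
theorem fg_of_algebraic [Finite ι] (htop : Algebra.adjoin K (Set.range x) = ⊤)
    (hx : PairwiseQCommute K x) {W : Submodule A M} (hW : W.FG)
    (halg : ∀ i, ∃ p : Polynomial K, p.Monic ∧
      ∀ w ∈ W, Polynomial.aeval (Algebra.lsmul K K M (x i)) p w = 0) :
    (W.restrictScalars K).FG := by
  have := Fintype.ofFinite ι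
  obtain ⟨s, rfl⟩ := hW
  obtain ⟨F, hF, hFW, hsF, hst⟩ :=
    exists_fg_stable _ halg hx s Submodule.subset_span Finset.univ
  have hle : Submodule.span A (s : Set M) ≤
      Submodule.ofStable htop F fun i ↦ hst i (Finset.mem_univ i) := Submodule.span_le.2 hsF
  rwa [le_antisymm (show (Submodule.span A (s : Set M)).restrictScalars K ≤ F from hle) hFW]

/-! ### Dévissage to generators acting by zero or injectively. -/

/-- On a finite dimensional module, the scalar by which two injective operators commute is a
root of unity. -/
theorem pow_finrank_eq_one [FiniteDimensional K M] {a b : A} {c : K} (h : a * b = c • (b * a))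
    (ha : Function.Injective fun w : M ↦ a • w) (hb : Function.Injective fun w : M ↦ b • w) :
    c ^ Module.finrank K M = 1 := by
  have hdet : ∀ y : A, (Function.Injective fun w : M ↦ y • w) →
      LinearMap.det (Algebra.lsmul K K M y) ≠ 0 := fun y hy h0 ↦
    LinearMap.det_eq_zero_iff_ker_ne_bot.1 h0 (LinearMap.ker_eq_bot.2 hy)
  have e := congr_arg (fun y ↦ LinearMap.det (Algebra.lsmul K K M y)) h
  simp only [map_mul, map_smul, LinearMap.det_smul] at e
  rw [mul_comm (LinearMap.det (Algebra.lsmul K K M b))] at e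
  exact (mul_eq_right₀ (mul_ne_zero (hdet a ha) (hdet b hb))).1 e.symm

theorem QCommutesOn.aeval_of_commute {W : Submodule A M} {f : Module.End K M}
    (hf : ∀ w ∈ W, f w ∈ W) (hc : ∀ i, ∀ w ∈ W, f (x i • w) = x i • f w) (p : Polynomial K) :
    QCommutesOn x W (Polynomial.aeval f p) := by
  have hpow : ∀ k, ∀ w ∈ W, (f ^ k) w ∈ W := fun k w hw ↦
    Submodule.map_pow_le (P := W.restrictScalars K) hf k ⟨w, hw, rfl⟩
  have hcomm : ∀ k i, ∀ w ∈ W, (f ^ k) (x i • w) = x i • (f ^ k) w := by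
    intro k i w hw
    induction k with
    | zero => rfl
    | succ k ih =>
      rw [pow_succ', Module.End.mul_apply, ih, hc i _ (hpow k w hw), Module.End.mul_apply]
  refine ⟨fun w hw ↦ ?_, fun i ↦ ⟨1, one_ne_zero, fun w hw ↦ ?_⟩⟩
  · rw [Polynomial.aeval_eq_sum_range, LinearMap.sum_apply]
    exact W.sum_mem fun k _ ↦ smul_mem_of_smul _ (hpow k w hw)
  · simp only [Polynomial.aeval_eq_sum_range, LinearMap.sum_apply, LinearMap.smul_apply,
      one_smul, Finset.smul_sum]
    refine Finset.sum_congr rfl fun k _ ↦ ?_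
    rw [hcomm k i w hw, smul_comm]

/-- The base case: every `x i` acts by zero or injectively. -/
theorem fg_of_zero_or_injective [Finite ι] [IsNoetherian A M]
    (htop : Algebra.adjoin K (Set.range x) = ⊤) (hx : PairwiseQCommute K x)
    {V : Submodule A M} (hV : IsEssentialSubmodule V) [FiniteDimensional K V]
    {W : Submodule A M}
    (hW : ∀ i, (∀ w ∈ W, x i • w = 0) ∨ ∀ w ∈ W, x i • w = 0 → w = 0) :
    (W.restrictScalars K).FG := by
  by_cases hbot : W = ⊥
  · rw [hbot]
    exact (Submodule.fg_bot : (⊥ : Submodule K M).FG)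
  have : FiniteDimensional K ↥(V ⊓ W) :=
    FiniteDimensional.of_injective
      ((Submodule.inclusion (inf_le_left : V ⊓ W ≤ V)).restrictScalars K)
      (Submodule.inclusion_injective inf_le_left)
  set d := Module.finrank K ↥(V ⊓ W) with hd
  have hd0 : d ≠ 0 := by
    have := Submodule.nontrivial_iff_ne_bot.2 (hV W hbot)
    exact Module.finrank_pos.ne'
  have hinj : ∀ i, (∀ w ∈ W, x i • w = 0 → w = 0) →
      Function.Injective fun w : ↥(V ⊓ W) ↦ x i • w := by
    intro i hi u v huv
    rw [← sub_eq_zero] at huv ⊢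
    refine Subtype.ext (hi _ (u - v).2.2 ?_)
    simpa [smul_sub] using congr_arg Subtype.val huv
  have hcomm : ∀ i j, ∀ w ∈ W,
      ((Algebra.lsmul K K M (x i)) ^ d) (x j • w) = x j • ((Algebra.lsmul K K M (x i)) ^ d) w := by
    intro i j w hw
    rw [← map_pow]
    change x i ^ d • x j • w = x j • x i ^ d • w
    rw [← mul_smul, ← mul_smul]
    rcases hW i with hi | hi
    -- Since `d ≠ 0`, a generator acting by zero has zero `d`-th power on `W`.
    · obtain ⟨e, he⟩ := Nat.exists_eq_succ_of_ne_zero hd0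
      rw [he, pow_succ, mul_assoc, mul_smul, mul_smul, hi _ (W.smul_mem _ hw),
        ← mul_assoc, mul_smul _ (x i), hi w hw, smul_zero, smul_zero]
    rcases hW j with hj | hj
    · rw [mul_smul, hj w hw, mul_smul, hj _ (W.smul_mem _ hw), smul_zero]
    obtain ⟨c, hc, h⟩ := hx i j
    have hcd : c ^ d = 1 := pow_finrank_eq_one (M := ↥(V ⊓ W)) h (hinj i hi) (hinj j hj)
    have hk : ∀ k, x i ^ k * x j = c ^ k • (x j * x i ^ k) := by
      intro k
      induction k with
      | zero => simp
      | succ k ih =>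
        rw [pow_succ', mul_assoc, ih, mul_smul_comm, ← mul_assoc, h, smul_mul_assoc, mul_assoc,
          smul_smul, ← pow_succ]
    rw [hk, hcd, one_smul]
  refine fg_of_algebraic htop hx (IsNoetherian.noetherian W) fun i ↦ ?_
  set g := Algebra.lsmul K K M (x i) with hg
  set g' := Algebra.lsmul K K ↥(V ⊓ W) (x i) with hg'
  have hres : ∀ (p : Polynomial K) (u : ↥(V ⊓ W)),
      ((Polynomial.aeval (g' ^ d) p u : ↥(V ⊓ W)) : M) = Polynomial.aeval (g ^ d) p (u : M) := by
    intro p u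
    rw [hg, hg', ← map_pow, ← map_pow, Polynomial.aeval_algHom_apply,
      Polynomial.aeval_algHom_apply]
    rfl
  have hq : QCommutesOn x W (Polynomial.aeval (g ^ d) (minpoly K (g' ^ d))) :=
    QCommutesOn.aeval_of_commute
      (fun w hw ↦ by rw [← map_pow]; exact W.smul_mem _ hw) (hcomm i) _
  obtain ⟨N, hN⟩ := hq.exists_pow_eq_zero htop hV fun w hw ↦ by
    rw [← hres _ ⟨w, hw⟩, minpoly.aeval]; rfl
  have hmon : (minpoly K (g' ^ d)).Monic := minpoly.monic (Algebra.IsIntegral.isIntegral _)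
  -- With `p` the minimal polynomial, `p(T ^ d) ^ N` annihilates `x i` on `W`.
  refine ⟨(Polynomial.expand K d (minpoly K (g' ^ d))) ^ N,
    (hmon.expand (Nat.pos_of_ne_zero hd0)).pow N, fun w hw ↦ ?_⟩
  rw [map_pow, Polynomial.expand_aeval]
  exact hN w hw

/-- `T` holds the generators still to be split; induction removes one by passing to its kernel and
to the image of a stable power. -/
theorem fg_of_zero_or_injective_outside [Finite ι] [IsNoetherian A M]
    (htop : Algebra.adjoin K (Set.range x) = ⊤) (hx : PairwiseQCommute K x)
    {V : Submodule A M} (hV : IsEssentialSubmodule V) [FiniteDimensional K V] (T : Finset ι) :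
    ∀ W : Submodule A M,
      (∀ i ∉ T, (∀ w ∈ W, x i • w = 0) ∨ ∀ w ∈ W, x i • w = 0 → w = 0) →
      (W.restrictScalars K).FG := by
  classical
  induction T using Finset.induction_on with
  | empty => exact fun W hW ↦ fg_of_zero_or_injective htop hx hV fun i ↦ hW i (by simp)
  | insert i T _ ih =>
    intro W hW
    have hq : QCommutesOn x W (Algebra.lsmul K K M (x i)) := qCommutesOn_smul hx i W
    obtain ⟨N, hN⟩ := hq.exists_pow_ker_stable htop
    have hW' : ∀ U ≤ W, ((∀ w ∈ U, x i • w = 0) ∨ ∀ w ∈ U, x i • w = 0 → w = 0) →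
        (U.restrictScalars K).FG := by
      intro U hU h
      refine ih U fun j hj ↦ ?_
      by_cases hji : j = i
      · rwa [hji]
      · exact (hW j (by simp [hj, hji])).imp (fun h w hw ↦ h w (hU hw))
          fun h w hw ↦ h w (hU hw)
    refine Submodule.fg_of_fg_map_pow hq.1
      (hW' (hq.ker htop) (fun w hw ↦ hw.1) (.inl fun w hw ↦ hw.2)) N
      (hW' ((hq.pow N).map htop) ?_ (.inr ?_))
    · rintro _ ⟨w, hw, rfl⟩
      exact (hq.pow N).1 w hw
    · rintro _ ⟨w, hw, rfl⟩ h
      refine hN w hw ?_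
      rw [pow_succ', Module.End.mul_apply]
      exact h

/-- A Noetherian module with a finite dimensional essential submodule is finite dimensional. -/
theorem finiteDimensional_of_essential [Finite ι] [IsNoetherian A M]
    (htop : Algebra.adjoin K (Set.range x) = ⊤) (hx : PairwiseQCommute K x)
    {V : Submodule A M} (hV : IsEssentialSubmodule V) [FiniteDimensional K V] :
    FiniteDimensional K M := by
  have := Fintype.ofFinite ι
  have := fg_of_zero_or_injective_outside htop hx hV Finset.univ ⊤ (by simp)
  exact Module.finite_def.2 this

/-! ### Reduction to cyclic submodules. -/

theorem IsEssentialSubmodule.comap_subtype {V : Submodule A M} (hV : IsEssentialSubmodule V)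
    (W : Submodule A M) : IsEssentialSubmodule (V.comap W.subtype) := by
  intro U hU h
  refine hV (U.map W.subtype) ?_ ?_
  · rwa [Ne, ← Submodule.map_bot W.subtype,
      (Submodule.map_injective_of_injective W.injective_subtype).eq_iff]
  · refine (Submodule.eq_bot_iff _).2 ?_
    rintro _ ⟨hv, u, hu, rfl⟩
    rw [(Submodule.eq_bot_iff _).1 h u ⟨hv, hu⟩, map_zero]

/-- A finitely generated locally finite module is finite dimensional. -/
theorem IsLocallyFiniteRep.finiteDimensional (hM : IsLocallyFiniteRep K A M)
    [Module.Finite A M] : FiniteDimensional K M := by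
  refine Module.finite_def.2 (Submodule.fg_induction (motive := fun N _ ↦ (N.restrictScalars K).FG)
    (fun m ↦ Module.Finite.iff_fg.1 (hM m)) (fun N₁ N₂ _ _ h₁ h₂ ↦ ?_) ⊤ Module.Finite.fg_top)
  convert h₁.sup h₂ using 1
  ext w
  simp [Submodule.mem_sup]

theorem IsLocallyFiniteRep.of_injective {N : Type*} [AddCommGroup N] [Module K N] [Module A N]
    [IsScalarTower K A N] (hN : IsLocallyFiniteRep K A N) (f : M →ₗ[A] N)
    (hf : Function.Injective f) : IsLocallyFiniteRep K A M := by
  intro m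
  have := hN (f m)
  let g : Submodule.span A {m} →ₗ[A] Submodule.span A {f m} :=
    f.restrict fun u hu ↦ by
      obtain ⟨a, rfl⟩ := Submodule.mem_span_singleton.1 hu
      exact Submodule.mem_span_singleton.2 ⟨a, (map_smul f a m).symm⟩
  exact FiniteDimensional.of_injective (g.restrictScalars K) fun u v huv ↦
    Subtype.ext (hf (congr_arg Subtype.val huv))

/-- Locally finite modules are closed under essential extensions, over a Noetherian algebra
generated by finitely many elements that commute up to nonzero scalars. -/
theorem IsLocallyFiniteRep.of_essential [Finite ι] [IsNoetherianRing A]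
    (htop : Algebra.adjoin K (Set.range x) = ⊤) (hx : PairwiseQCommute K x)
    {V : Submodule A M} (hess : IsEssentialSubmodule V) (hV : IsLocallyFiniteRep K A V) :
    IsLocallyFiniteRep K A M := by
  intro m
  have : IsNoetherian A (Submodule.span A {m}) :=
    isNoetherian_span_of_finite _ (Set.finite_singleton m)
  let f : V.comap (Submodule.span A {m}).subtype →ₗ[A] V :=
    (Submodule.span A {m}).subtype.restrict fun _ hu ↦ hu
  have hf : Function.Injective f := fun u v huv ↦
    Subtype.ext (Subtype.ext (congr_arg (fun v : V ↦ (v : M)) huv))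
  have := (hV.of_injective f hf).finiteDimensional
  exact finiteDimensional_of_essential htop hx (hess.comap_subtype _)

end LocallyFinite

/-! ### Application to quantum affine space. -/

theorem QuantumAffineSpace.adjoin_generators {K : Type*} [Field K] {n : ℕ}
    (q : Fin n → Fin n → Kˣ) :
    Algebra.adjoin K (Set.range fun i ↦
      RingQuot.mkAlgHom K (QuantumAffineRel q) (FreeAlgebra.ι K i)) = ⊤ := by
  rw [Set.range_comp' , ← AlgHom.map_adjoin, FreeAlgebra.adjoin_range_ι, Algebra.map_top,
    AlgHom.range_eq_top]
  exact RingQuot.mkAlgHom_surjective _ _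

theorem QuantumAffineSpace.pairwiseQCommute_generators {K : Type*} [Field K] {n : ℕ}
    (q : Fin n → Fin n → Kˣ) :
    PairwiseQCommute K fun i ↦ RingQuot.mkAlgHom K (QuantumAffineRel q) (FreeAlgebra.ι K i) :=
  fun i j ↦ ⟨q i j, (q i j).ne_zero, by
    rw [← map_mul, ← map_mul, ← map_smul]
    exact RingQuot.mkAlgHom_rel K (QuantumAffineRel.rel i j)⟩

theorem theorem2p9 {K : Type*} [Field K] [IsAlgClosed K] (n : ℕ) (q : Fin n → Fin n → Kˣ)
    (hq_diag : ∀ i, q i i = 1) (hq_symm : ∀ i j, q j i = (q i j)⁻¹)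
    {E : Type*} [AddCommGroup E] [Module K E] [Module (QuantumAffineSpace q) E]
    [IsScalarTower K (QuantumAffineSpace q) E]
    (V : Submodule (QuantumAffineSpace q) E) (hess : IsEssentialSubmodule V)
    (hV : IsLocallyFiniteRep K (QuantumAffineSpace q) V) :
    IsLocallyFiniteRep K (QuantumAffineSpace q) E := by
  have htop := QuantumAffineSpace.adjoin_generators q
  have hx := QuantumAffineSpace.pairwiseQCommute_generators q
  have : IsNoetherianRing (QuantumAffineSpace q) := hx.isNoetherianRing MonomialOrder.lex htop
  exact hV.of_essential htop hx hess
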